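/- Let $A\in\mathbb R^{n\times n}$. For $\alpha\subseteq\{1,\dots,n\}$ with $\det A_{\alpha\alpha}\neq 0$ (by convention $\det A_{\emptyset\emptyset}=1$), the legitimate principal pivot transform (PPT) of $A$ with respect to $\alpha$ is the matrix $M$ with blocks $$M_{\alpha\alpha}=A_{\alpha\alpha}^{-1},\quad M_{\alpha\bar\alpha}=-A_{\alpha\alpha}^{-1}A_{\alpha\bar\alpha},\quad M_{\bar\alpha\alpha}=A_{\bar\alpha\alpha}A_{\alpha\alpha}^{-1},\quad M_{\bar\alpha\bar\alpha}=A_{\bar\alpha\bar\alpha}-A_{\bar\alpha\alpha}A_{\alpha\alpha}^{-1}A_{\alpha\bar\alpha},$$ so that $M=A$ for $\alpha=\emptyset$. A real square matrix $B$ is called - $Z$ if its off-diagonal entries are $\le 0$; $P_0$ if all its principal minors are $\ge 0$; $K_0$ if it is both $Z$ and $P_0$; - copositive if $x^TBx\ge 0$ for all $x\ge 0$; almost $C_0$ (for $B$ of order $n$) if all its principal submatrices of order $n-1$ are copositive but $B$ is not; - $E_0$ if for every $0\ne x\ge 0$ there is $i$ with $x_i>0$ and $(Bx)_i\ge 0$;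 - $E_0^s$ if $B\in E_0$ and $x\ge 0$, $Bx\ge 0$, $x^TBx=0$ imply $B^Tx\le 0$; - $\tilde E_0^s$ if $B\in E_0^s$ and, whenever $x\ge 0$, $Bx\ge 0$, $x^TBx=0$, one has for every $i$: $(B^Tx)_i\ne 0\Rightarrow (Bx)_i\neq 0$; completely $\tilde E_0^s$ if all its principal submatrices are $\tilde E_0^s$; - column sufficient if for every $x$: $x_i(Bx)_i\le 0$ for all $i$ implies $x_i(Bx)_i=0$ for all $i$; sufficient if both $B$ and $B^T$ are column sufficient. **Theorem.** Let $A\in\mathbb R^{n\times n}$ be an $E_0$-matrix with the $(++)$-property, i.e. $AX$ is a $Z$-matrix for some $X\in K_0$; if $n=2$, assume moreover that $\det A\neq 0$. Suppose that every legitimate PPT $M$ of $A$ is either almost $C_0$, or completely $\tilde E_0^s$ with all $2\times 2$ principal submatrices of $M$ of full rank. Then $A$ is sufficient. -/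

import Mathlib

namespace LCP

open Matrix

/-- The principal submatrix `A_{αα}`. -/
abbrev principalSub {ι : Type*} (A : Matrix ι ι ℝ) (α : Finset ι) :
    Matrix {i // i ∈ α} {i // i ∈ α} ℝ :=
  A.toBlock (fun i => i ∈ α) (fun i => i ∈ α)

/-- The principal pivot transform of `A` with respect to `α` (meaningful when
`det A_{αα} ≠ 0`): with respect to the partition of the index set into `α` and its complement,
it is the block matrix with blocks `A_{αα}⁻¹`, `-A_{αα}⁻¹ A_{αᾱ}`, `A_{ᾱα} A_{αα}⁻¹` and
`A_{ᾱᾱ} - A_{ᾱα} A_{αα}⁻¹ A_{αᾱ}`. -/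
noncomputable def ppt {ι : Type*} [Fintype ι] [DecidableEq ι]
    (A : Matrix ι ι ℝ) (α : Finset ι) : Matrix ι ι ℝ :=
  let P := principalSub A α
  let Q := A.toBlock (fun i => i ∈ α) (fun i => ¬ i ∈ α)
  let R := A.toBlock (fun i => ¬ i ∈ α) (fun i => i ∈ α)
  let S := A.toBlock (fun i => ¬ i ∈ α) (fun i => ¬ i ∈ α)
  Matrix.reindex (Equiv.sumCompl (fun i => i ∈ α)) (Equiv.sumCompl (fun i => i ∈ α))
    (Matrix.fromBlocks P⁻¹ (-(P⁻¹ * Q)) (R * P⁻¹) (S - R * P⁻¹ * Q))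

/-- `M` is a legitimate principal pivot transform of `A`. The choice `α = ∅`, for which the
determinant is `1` and `M = A`, is included. -/
def IsLegitimatePPT {ι : Type*} [Fintype ι] [DecidableEq ι] (A M : Matrix ι ι ℝ) : Prop :=
  ∃ α : Finset ι, (principalSub A α).det ≠ 0 ∧ M = ppt A α

/-- The solution set `SOL(q, A)` of the linear complementarity problem. -/
def SOL {ι : Type*} [Fintype ι] (q : ι → ℝ) (A : Matrix ι ι ℝ) : Set (ι → ℝ) :=
  {z | 0 ≤ z ∧ 0 ≤ q + A *ᵥ z ∧ z ⬝ᵥ (q + A *ᵥ z) = 0}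

/-- Column sufficient matrices. -/
def IsColumnSufficient {ι : Type*} [Fintype ι] (A : Matrix ι ι ℝ) : Prop :=
  ∀ x : ι → ℝ, (∀ i, x i * (A *ᵥ x) i ≤ 0) → ∀ i, x i * (A *ᵥ x) i = 0

/-- Row sufficient matrices. -/
def IsRowSufficient {ι : Type*} [Fintype ι] (A : Matrix ι ι ℝ) : Prop :=
  IsColumnSufficient Aᵀ

/-- Sufficient matrices. -/
def IsSufficient {ι : Type*} [Fintype ι] (A : Matrix ι ι ℝ) : Prop :=
  IsColumnSufficient A ∧ IsRowSufficient A

/-- `P₀`-matrices: all principal minors are nonnegative. -/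
def IsP0 {ι : Type*} [DecidableEq ι] (A : Matrix ι ι ℝ) : Prop :=
  ∀ α : Finset ι, 0 ≤ (principalSub A α).det

/-- `Z`-matrices: all off-diagonal entries are nonpositive. -/
def IsZ {ι : Type*} (A : Matrix ι ι ℝ) : Prop :=
  ∀ i j, i ≠ j → A i j ≤ 0

/-- `K₀`-matrices. -/
def IsK0 {ι : Type*} [DecidableEq ι] (A : Matrix ι ι ℝ) : Prop :=
  IsZ A ∧ IsP0 A

/-- The `(++)`-property. -/
def HasPlusPlus {ι : Type*} [Fintype ι] [DecidableEq ι] (A : Matrix ι ι ℝ) : Prop :=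
  ∃ X : Matrix ι ι ℝ, IsK0 X ∧ IsZ (A * X)

/-- Copositive (`C₀`) matrices. -/
def IsCopositive {ι : Type*} [Fintype ι] (A : Matrix ι ι ℝ) : Prop :=
  ∀ x : ι → ℝ, 0 ≤ x → 0 ≤ x ⬝ᵥ (A *ᵥ x)

/-- `A` is copositive of order `k`: all its principal submatrices of order `k` are copositive. -/
def IsCopositiveOfOrder {ι : Type*} (A : Matrix ι ι ℝ) (k : ℕ) : Prop :=
  ∀ α : Finset ι, α.card = k → IsCopositive (principalSub A α)

/-- Almost copositive (almost `C₀`) matrices: copositive of order `n - 1` but not of order `n`. -/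
def IsAlmostCopositive {n : ℕ} (A : Matrix (Fin n) (Fin n) ℝ) : Prop :=
  IsCopositiveOfOrder A (n - 1) ∧ ¬ IsCopositiveOfOrder A n

/-- Semimonotone (`E₀`) matrices. -/
def IsE0 {ι : Type*} [Fintype ι] (A : Matrix ι ι ℝ) : Prop :=
  ∀ x : ι → ℝ, 0 ≤ x → x ≠ 0 → ∃ i, 0 < x i ∧ 0 ≤ (A *ᵥ x) i

/-- Semimonotone star (`E₀ˢ`) matrices. -/
def IsE0s {ι : Type*} [Fintype ι] (A : Matrix ι ι ℝ) : Prop :=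
  IsE0 A ∧ ∀ x : ι → ℝ, x ⬝ᵥ (A *ᵥ x) = 0 → 0 ≤ A *ᵥ x → 0 ≤ x → Aᵀ *ᵥ x ≤ 0

/-- `Ẽ₀ˢ`-matrices. -/
def IsE0sTilde {ι : Type*} [Fintype ι] (A : Matrix ι ι ℝ) : Prop :=
  IsE0s A ∧ ∀ x ∈ SOL 0 A, ∀ i, (Aᵀ *ᵥ x) i ≠ 0 → (A *ᵥ x) i ≠ 0

/-- Completely `Ẽ₀ˢ`-matrices: all principal submatrices are `Ẽ₀ˢ`. -/
def IsCompletelyE0sTilde {ι : Type*} (A : Matrix ι ι ℝ) : Prop :=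
  ∀ α : Finset ι, IsE0sTilde (principalSub A α)

/-- All second order principal submatrices have full rank. -/
def HasFullRankOrderTwo {ι : Type*} (A : Matrix ι ι ℝ) : Prop :=
  ∀ α : Finset ι, α.card = 2 → (principalSub A α).rank = 2

end LCP

/-! Everything rests on one property of all legitimate PPTs `M`: the diagonal is nonnegative, and `M
k k = 0` forces `M k j * M j k < 0` or `M k j = M j k = 0` for each `j ≠ k` (`HasSignPattern`). This
alone gives sufficiency (`isSufficient_of_hasSignPattern`): it makes all principal minors
nonnegative, and a vector violating column sufficiency, pivoted until its support is smallest, would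
then yield a vector whose signs a `P₀`-matrix strictly reverses.

For completely `Ẽ₀ˢ` matrices with full-rank order-two blocks, the pattern follows by testing
nonnegative vectors supported on two indices. An almost copositive form is nonnegative on every
vector with a zero coordinate; if `3 ≤ n`, all vectors supported on two indices qualify. For `n = 2`
they do not, so there the determinant is shown to be positive directly. -/

namespace LCP

open Matrix
open scoped symmDiff

/-! ### Principal minors, pivoting, and sufficiency from the sign pattern -/

section Minors

variable {ι : Type*} [Fintype ι] [DecidableEq ι]

/-- The matrix whose rows indexed by `α` are those of `A`, the others being rows of the identity. -/
def pivRow (A : Matrix ι ι ℝ) (α : Finset ι) : Matrix ι ι ℝ :=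
  fun i => if i ∈ α then A i else (1 : Matrix ι ι ℝ) i

/-- The principal minor of `A` on `α`. -/
def minor (A : Matrix ι ι ℝ) (α : Finset ι) : ℝ := (pivRow A α).det

theorem minor_eq_det (A : Matrix ι ι ℝ) (α : Finset ι) :
    minor A α = (principalSub A α).det := by
  unfold minor
  rw [Matrix.twoBlockTriangular_det _ (fun i => i ∈ α)]
  · have h1 : toSquareBlockProp (pivRow A α) (fun i => i ∈ α) = principalSub A α := by
      ext i j
      simp [toSquareBlockProp, pivRow, principalSub, toBlock, i.2]
    have h2 : toSquareBlockProp (pivRow A α) (fun i => ¬ i ∈ α) = 1 := by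
      ext i j
      simp [toSquareBlockProp, pivRow, i.2, Matrix.one_apply, Subtype.ext_iff]
    rw [h1, h2, det_one, mul_one]
    congr!
  · intro i hi j hj
    have : i ≠ j := fun h => hi (h ▸ hj)
    simp [pivRow, hi, this]

theorem minor_transpose (A : Matrix ι ι ℝ) (α : Finset ι) : minor Aᵀ α = minor A α := by
  rw [minor_eq_det, minor_eq_det, ← det_transpose]
  rfl

theorem minor_empty (A : Matrix ι ι ℝ) : minor A ∅ = 1 := by
  have : pivRow A ∅ = 1 := by ext i j; simp [pivRow]
  rw [minor, this, det_one]

theorem minor_univ (A : Matrix ι ι ℝ) : minor A Finset.univ = A.det := by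
  have : pivRow A Finset.univ = A := by ext i j; simp [pivRow]
  rw [minor, this]

theorem minor_singleton (A : Matrix ι ι ℝ) (i : ι) : minor A {i} = A i i := by
  rw [minor_eq_det]
  let _ : Unique {j // j ∈ ({i} : Finset ι)} :=
    ⟨⟨⟨i, by simp⟩⟩, fun x => Subtype.ext (Finset.mem_singleton.1 x.2)⟩
  rw [det_unique]
  rfl

theorem minor_pair (A : Matrix ι ι ℝ) {i j : ι} (h : i ≠ j) :
    minor A {i, j} = A i i * A j j - A i j * A j i := by
  rw [minor_eq_det]
  let f : Fin 2 → {k // k ∈ ({i, j} : Finset ι)} := ![⟨i, by simp⟩, ⟨j, by simp⟩]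
  have hf : Function.Bijective f := by
    constructor
    · intro a b hab
      fin_cases a <;> fin_cases b <;> simp_all [f, Subtype.ext_iff]
    · rintro ⟨k, hk⟩
      rcases Finset.mem_insert.1 hk with rfl | hk
      · exact ⟨0, rfl⟩
      · rw [Finset.mem_singleton] at hk
        subst hk
        exact ⟨1, rfl⟩
  rw [← det_submatrix_equiv_self (Equiv.ofBijective f hf), det_fin_two]
  rfl

theorem pivRow_eq_reindex (A : Matrix ι ι ℝ) (α : Finset ι) :
    pivRow A α = Matrix.reindex (Equiv.sumCompl (fun i => i ∈ α))
      (Equiv.sumCompl (fun i => i ∈ α))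
      (Matrix.fromBlocks (principalSub A α)
        (A.toBlock (fun i => i ∈ α) (fun i => ¬ i ∈ α)) 0 1) := by
  rw [← Equiv.symm_apply_eq]
  ext i j
  rcases i with i | i <;> rcases j with j | j
  · simp [pivRow, i.2]
  · simp [pivRow, i.2]
  · have : i.1 ≠ j.1 := fun h => i.2 (h ▸ j.2)
    simp [pivRow, i.2, Matrix.one_apply, this]
  · simp [pivRow, i.2, Matrix.one_apply, ← Subtype.ext_iff]

theorem pivRow_compl_eq_reindex (A : Matrix ι ι ℝ) (α : Finset ι) :
    pivRow A αᶜ = Matrix.reindex (Equiv.sumCompl (fun i => i ∈ α))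
      (Equiv.sumCompl (fun i => i ∈ α))
      (Matrix.fromBlocks 1 0 (A.toBlock (fun i => ¬ i ∈ α) (fun i => i ∈ α))
        (A.toBlock (fun i => ¬ i ∈ α) (fun i => ¬ i ∈ α))) := by
  rw [← Equiv.symm_apply_eq]
  ext i j
  rcases i with i | i <;> rcases j with j | j
  · simp [pivRow, i.2, Matrix.one_apply]
  · have : i.1 ≠ j.1 := fun h => j.2 (h ▸ i.2)
    simp [pivRow, i.2, Matrix.one_apply, this]
  · simp [pivRow, i.2]
  · simp [pivRow, i.2]

/-- The exchange property of pivoting: with `y = A *ᵥ x`, the PPT sends the vector made of `y` on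
`α` and `x` off `α` to the complementary mixture. -/
theorem ppt_mul_pivRow (A : Matrix ι ι ℝ) (α : Finset ι) (h : minor A α ≠ 0) :
    ppt A α * pivRow A α = pivRow A αᶜ := by
  rw [minor_eq_det] at h
  have hu : IsUnit (principalSub A α).det := isUnit_iff_ne_zero.2 h
  rw [pivRow_eq_reindex, pivRow_compl_eq_reindex, ppt]
  simp only [reindex_apply, submatrix_mul_equiv, fromBlocks_multiply]
  rw [Matrix.nonsing_inv_mul _ hu, Matrix.mul_assoc _ _ (principalSub A α),
    Matrix.nonsing_inv_mul _ hu]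
  simp

/-- Resetting to identity the rows outside `β` of the left factor in `ppt_mul_pivRow` turns the
product into `pivRow A (α ∆ β)`; then take determinants. -/
theorem minor_ppt (A : Matrix ι ι ℝ) (α β : Finset ι) (h : minor A α ≠ 0) :
    minor (ppt A α) β * minor A α = minor A (α ∆ β) := by
  unfold minor
  rw [← det_mul]
  congr 1
  have key := ppt_mul_pivRow A α h
  ext i j
  by_cases hb : i ∈ β
  · have h1 : (pivRow (ppt A α) β * pivRow A α) i j = (ppt A α * pivRow A α) i j := by
      simp [Matrix.mul_apply, pivRow, hb]
    rw [h1, key]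
    by_cases ha : i ∈ α <;> simp [pivRow, ha, hb, Finset.mem_symmDiff]
  · have h1 : (pivRow (ppt A α) β * pivRow A α) i j
        = ((1 : Matrix ι ι ℝ) * pivRow A α) i j := by
      simp only [Matrix.mul_apply, pivRow, hb, if_false]
    rw [h1, Matrix.one_mul]
    by_cases ha : i ∈ α <;> simp [pivRow, ha, hb, Finset.mem_symmDiff]

theorem pivRow_mulVec_apply (A : Matrix ι ι ℝ) (α : Finset ι) (x : ι → ℝ) (i : ι) :
    (pivRow A α *ᵥ x) i = if i ∈ α then (A *ᵥ x) i else x i := by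
  by_cases h : i ∈ α
  · simp [Matrix.mulVec, dotProduct, pivRow, h]
  · have : (pivRow A α *ᵥ x) i = ((1 : Matrix ι ι ℝ) *ᵥ x) i := by
      simp only [Matrix.mulVec, pivRow, h, if_false]
    rw [this, one_mulVec, if_neg h]

/-- Transposition commutes with pivoting up to the sign of the off-diagonal blocks, which leaves the
products `M k j * M j k` unchanged. -/
theorem ppt_transpose_apply (A : Matrix ι ι ℝ) (α : Finset ι) (i j : ι) :
    ppt Aᵀ α i j = if (i ∈ α ↔ j ∈ α) then ppt A α j i else - ppt A α j i := by
  have hP : (principalSub Aᵀ α)⁻¹ = ((principalSub A α)⁻¹)ᵀ := by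
    rw [Matrix.transpose_nonsing_inv]; rfl
  have hQ : Aᵀ.toBlock (fun i => i ∈ α) (fun i => ¬ i ∈ α)
      = (A.toBlock (fun i => ¬ i ∈ α) (fun i => i ∈ α))ᵀ := rfl
  have hR : Aᵀ.toBlock (fun i => ¬ i ∈ α) (fun i => i ∈ α)
      = (A.toBlock (fun i => i ∈ α) (fun i => ¬ i ∈ α))ᵀ := rfl
  have hS : Aᵀ.toBlock (fun i => ¬ i ∈ α) (fun i => ¬ i ∈ α)
      = (A.toBlock (fun i => ¬ i ∈ α) (fun i => ¬ i ∈ α))ᵀ := rfl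
  obtain ⟨i, rfl⟩ := (Equiv.sumCompl (fun i => i ∈ α)).surjective i
  obtain ⟨j, rfl⟩ := (Equiv.sumCompl (fun i => i ∈ α)).surjective j
  simp only [ppt, hP, hQ, hR, hS, ← transpose_mul]
  rcases i with i | i <;> rcases j with j | j <;>
    simp [i.2, j.2, -transpose_mul, Matrix.mul_assoc]

/-- A matrix whose principal minors are nonnegative becomes nonsingular, of positive determinant,
after adding a positive diagonal. -/
theorem det_add_diagonal_pos (B : Matrix ι ι ℝ) (hB : ∀ α, 0 ≤ minor B α)
    (d : ι → ℝ) (hd : ∀ i, 0 < d i) : 0 < (B + diagonal d).det := by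
  have hterm : ∀ s : Finset ι,
      (detRowAlternating (R := ℝ) (n := ι)).toMultilinearMap (s.piecewise B (diagonal d))
        = (∏ i, if i ∈ s then 1 else d i) * minor B s := by
    intro s
    rw [minor, ← det_diagonal, ← det_mul]
    change det _ = _
    congr 1
    ext i j
    rw [diagonal_mul]
    by_cases h : i ∈ s
    · simp [h, pivRow, Finset.piecewise]
    · simp [h, pivRow, Finset.piecewise, Matrix.one_apply, diagonal_apply]
  -- Multilinearity in the rows: each row is taken either from `B` or from the diagonal.
  have hexp : (B + diagonal d).det = ∑ s : Finset ι, (∏ i, if i ∈ s then 1 else d i) * minor B s := by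
    rw [← Finset.sum_congr rfl fun s _ => hterm s]
    exact (detRowAlternating (R := ℝ) (n := ι)).toMultilinearMap.map_add_univ B (diagonal d)
  have hprod : ∀ s : Finset ι, 0 < ∏ i, if i ∈ s then 1 else d i := fun s =>
    Finset.prod_pos fun i _ => by split_ifs <;> simp [hd]
  rw [hexp]
  refine Finset.sum_pos' (fun s _ => mul_nonneg (hprod s).le (hB s)) ⟨∅, Finset.mem_univ _, ?_⟩
  rw [minor_empty, mul_one]
  exact hprod ∅

/-- A matrix with nonnegative principal minors does not strictly reverse the sign of all
nonzero entries of a nonzero vector. -/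
theorem exists_nonneg_mul_mulVec (M : Matrix ι ι ℝ) (hM : ∀ α, 0 ≤ minor M α)
    (w : ι → ℝ) (hw : w ≠ 0) : ∃ k, w k ≠ 0 ∧ 0 ≤ w k * (M *ᵥ w) k := by
  by_contra! hcon
  let B : Matrix ι ι ℝ := fun i => if w i = 0 then 0 else M i
  have hB : ∀ α, 0 ≤ minor B α := by
    intro α
    by_cases hα : ∃ i ∈ α, w i = 0
    · obtain ⟨i, hi, hwi⟩ := hα
      refine (det_eq_zero_of_row_eq_zero i fun j => ?_).ge
      simp [pivRow, hi, B, hwi]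
    · push Not at hα
      convert hM α using 1
      unfold minor
      congr 1
      ext i j
      by_cases hi : i ∈ α
      · simp [pivRow, hi, B, hα i hi]
      · simp [pivRow, hi]
  -- Chosen so that `B + diagonal d` annihilates `w`; strict sign reversal makes `d` positive.
  let d : ι → ℝ := fun i => if w i = 0 then 1 else - (M *ᵥ w) i / w i
  have hd : ∀ i, 0 < d i := by
    intro i
    by_cases hi : w i = 0
    · simp [d, hi]
    · simp only [d, hi, if_false]
      have h2 : 0 < w i ^ 2 := by positivity
      have : -(M *ᵥ w) i / w i = -(w i * (M *ᵥ w) i) / w i ^ 2 := by field_simp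
      rw [this]
      exact div_pos (by linarith [hcon i hi]) h2
  have hdet := det_add_diagonal_pos B hB d hd
  refine hdet.ne' (Matrix.exists_mulVec_eq_zero_iff.1 ⟨w, hw, ?_⟩)
  ext i
  rw [add_mulVec, Pi.add_apply, mulVec_diagonal, Pi.zero_apply]
  by_cases hi : w i = 0
  · simp [Matrix.mulVec, B, hi]
  · have : (B *ᵥ w) i = (M *ᵥ w) i := by simp [Matrix.mulVec, B, hi]
    rw [this]
    simp only [d, hi, if_false]
    field_simp
    ring

/-- Nonnegative diagonal, and entries symmetric to each other in the row and column of a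
vanishing diagonal entry have opposite signs. -/
def HasSignPattern (M : Matrix ι ι ℝ) : Prop :=
  ∀ k, 0 ≤ M k k ∧
    (M k k = 0 → ∀ j, j ≠ k → M k j * M j k < 0 ∨ (M k j = 0 ∧ M j k = 0))

/-- At a minimal `α` with negative minor, all minors of the PPT on nonempty subsets of `α` are
nonpositive. The sign pattern then makes its whole `α`-block vanish, although that block is an
inverse. -/
theorem minor_nonneg_of_hasSignPattern (A : Matrix ι ι ℝ)
    (hD : ∀ α, minor A α ≠ 0 → HasSignPattern (ppt A α)) (α : Finset ι) :
    0 ≤ minor A α := by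
  induction α using Finset.strongInduction with
  | H α ih =>
    by_contra! hneg
    have hM := hD α hneg.ne
    set M := ppt A α with hMdef
    have hsub : ∀ β ⊆ α, β.Nonempty → minor M β ≤ 0 := by
      intro β hβ hne
      have h1 := minor_ppt A α β hneg.ne
      have h2 : 0 ≤ minor A (α ∆ β) := by
        apply ih
        rw [symmDiff_of_ge (show β ≤ α from hβ)]
        exact Finset.sdiff_ssubset hβ hne
      rw [← h1] at h2
      exact nonpos_of_mul_nonneg_left h2 hneg
    have hdiag : ∀ i ∈ α, M i i = 0 := fun i hi => by
      have := hsub {i} (by simpa using hi) (by simp)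
      rw [minor_singleton] at this
      exact le_antisymm this (hM i).1
    have hzero : principalSub M α = 0 := by
      ext i j
      change M i j = 0
      by_cases hij : i.1 = j.1
      · rw [← hij]; exact hdiag i i.2
      · rcases (hM i).2 (hdiag i i.2) j (Ne.symm hij) with h | h
        · have h3 := hsub {i.1, j.1} (by
            intro k hk
            rcases Finset.mem_insert.1 hk with rfl | hk
            · exact i.2
            · rw [Finset.mem_singleton.1 hk]; exact j.2) (by simp)
          rw [minor_pair M hij, hdiag i i.2] at h3
          linarith
        · exact h.1
    have hne : α.Nonempty := by
      rw [Finset.nonempty_iff_ne_empty]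
      rintro rfl
      rw [minor_empty] at hneg
      linarith
    have h1 := minor_ppt A α α hneg.ne
    have : Nonempty {i // i ∈ α} := hne.to_subtype
    rw [minor_eq_det (ppt A α), ← hMdef, hzero, det_zero, symmDiff_self, Finset.bot_eq_empty,
      minor_empty] at h1
    linarith

theorem isColumnSufficient_of_hasSignPattern (A : Matrix ι ι ℝ)
    (hD : ∀ α, minor A α ≠ 0 → HasSignPattern (ppt A α)) : IsColumnSufficient A := by
  intro x hx
  by_contra! hcon
  obtain ⟨k₀, hk₀⟩ := hcon
  have hA := minor_nonneg_of_hasSignPattern A hD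
  let U : Finset ι → ι → ℝ := fun α => pivRow A α *ᵥ x
  have hUapp : ∀ α i, U α i = if i ∈ α then (A *ᵥ x) i else x i := fun α i =>
    pivRow_mulVec_apply A α x i
  let supp : Finset ι → Finset ι := fun α => Finset.univ.filter fun i => U α i ≠ 0
  -- Among all legitimate pivots, the mixture `u` of `x` and `A *ᵥ x` is taken with the fewest
  -- nonzero entries.
  obtain ⟨α, hα, hmin⟩ := Finset.exists_min_image
    (Finset.univ.filter fun α : Finset ι => minor A α ≠ 0) (fun α => (supp α).card)
    ⟨∅, by simp [minor_empty]⟩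
  simp only [Finset.mem_filter, Finset.mem_univ, true_and] at hα hmin
  set M := ppt A α with hMdef
  set u := U α with hu
  set v := U αᶜ with hv
  have hvu : M *ᵥ u = v := by
    simp only [hu, hv, U, mulVec_mulVec, hMdef, ppt_mul_pivRow A α hα]
  have huv : ∀ i, u i * v i = x i * (A *ᵥ x) i := fun i => by
    rw [hu, hv, hUapp, hUapp]
    by_cases h : i ∈ α <;> simp [h, mul_comm]
  have hUsymm : ∀ β i, U (α ∆ β) i = if i ∈ β then v i else u i := fun β i => by
    rw [hu, hv, hUapp, hUapp, hUapp]
    by_cases h : i ∈ α <;> by_cases h' : i ∈ β <;> simp [h, h', Finset.mem_symmDiff]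
  -- A further pivot on `β` would swap `u` and `v` there, removing `k` from the support and adding
  -- nothing, against minimality.
  have hpiv : ∀ β : Finset ι, (∀ i ∈ β, u i ≠ 0) → (∃ k ∈ β, v k = 0) → minor M β = 0 := by
    rintro β hβ ⟨k, hk, hvk⟩
    by_contra hne
    have hleg : minor A (α ∆ β) ≠ 0 := by
      rw [← minor_ppt A α β hα]
      exact mul_ne_zero hne hα
    refine (hmin _ hleg).not_gt (Finset.card_lt_card ?_)
    rw [Finset.ssubset_iff_of_subset]
    · refine ⟨k, ?_, ?_⟩
      · simpa [supp] using hβ k hk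
      · simp [supp, hUsymm, hk, hvk]
    · intro i hi
      simp only [supp, Finset.mem_filter, Finset.mem_univ, true_and, hUsymm] at hi ⊢
      by_cases h : i ∈ β
      · exact hβ i h
      · simpa [h] using hi
  have hM := hD α hα
  have hdiag : ∀ k, u k ≠ 0 → v k = 0 → M k k = 0 := fun k h1 h2 => by
    rw [← minor_singleton M k]
    exact hpiv {k} (by simpa using h1) ⟨k, by simp, h2⟩
  have hoff : ∀ k j, u k ≠ 0 → v k = 0 → u j ≠ 0 → j ≠ k → M j k = 0 := by
    intro k j h1 h2 h3 hjk
    have h0 := hdiag k h1 h2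
    rcases (hM k).2 h0 j hjk with h | h
    · have := hpiv {k, j} (by simp [h1, h3]) ⟨k, by simp, h2⟩
      rw [minor_pair M hjk.symm, h0] at this
      linarith
    · exact h.2
  -- By `hoff`, deleting the entries with `v i = 0` does not affect the rows where `u` and `v` are
  -- both nonzero, so `M` strictly reverses the signs of `w` on its support.
  let w : ι → ℝ := fun i => if v i = 0 then 0 else u i
  have hw : w ≠ 0 := by
    intro h
    have := congrFun h k₀
    rw [← huv] at hk₀
    simp only [w, Pi.zero_apply, right_ne_zero_of_mul hk₀, if_false] at this
    exact left_ne_zero_of_mul hk₀ this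
  have hMminor : ∀ β, 0 ≤ minor M β := fun β => by
    have h1 := minor_ppt A α β hα
    have h2 : 0 < minor A α := lt_of_le_of_ne (hA α) hα.symm
    exact nonneg_of_mul_nonneg_left (h1 ▸ hA _) h2
  obtain ⟨j, hj, hj'⟩ := exists_nonneg_mul_mulVec M hMminor w hw
  have hvj : v j ≠ 0 := by
    intro h; simp [w, h] at hj
  have hwj : w j = u j := by simp [w, hvj]
  have huj : u j ≠ 0 := hwj ▸ hj
  have hMw : (M *ᵥ w) j = v j := by
    rw [← hvu]
    refine Finset.sum_congr rfl fun l _ => ?_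
    change M j l * w l = M j l * u l
    by_cases hl : v l = 0
    · by_cases hul : u l = 0
      · simp [w, hul]
      · rw [hoff l j hul hl huj (by rintro rfl; exact hvj hl)]
        simp
    · simp [w, hl]
  rw [hwj, hMw] at hj'
  have hle : u j * v j ≤ 0 := huv j ▸ hx j
  exact mul_ne_zero huj hvj (le_antisymm hle hj')

theorem isSufficient_of_hasSignPattern (A : Matrix ι ι ℝ)
    (hD : ∀ α, minor A α ≠ 0 → HasSignPattern (ppt A α)) : IsSufficient A := by
  refine ⟨isColumnSufficient_of_hasSignPattern A hD,
    isColumnSufficient_of_hasSignPattern Aᵀ fun α hα k => ?_⟩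
  rw [minor_transpose] at hα
  obtain ⟨h1, h2⟩ := hD α hα k
  simp only [ppt_transpose_apply, iff_self, if_true]
  refine ⟨h1, fun h0 j hj => ?_⟩
  have h3 := h2 h0 j hj
  by_cases hkj : (k ∈ α ↔ j ∈ α)
  · simp only [hkj, if_true]
    rwa [mul_comm, and_comm]
  · have hjk : ¬ (j ∈ α ↔ k ∈ α) := fun h => hkj h.symm
    simp only [hkj, hjk, if_false, neg_mul_neg, neg_eq_zero]
    rwa [mul_comm, and_comm]

end Minors

/-! ### Principal submatrices as restrictions to vectors supported on `α` -/

section PrincipalSub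

variable {ι : Type*} [Fintype ι]

theorem sum_subtype_of_support (α : Finset ι) (f : ι → ℝ) (hf : ∀ i, i ∉ α → f i = 0) :
    ∑ i : {i // i ∈ α}, f i = ∑ i, f i := by
  rw [Finset.sum_coe_sort α f]
  exact Finset.sum_subset (Finset.subset_univ α) fun i _ hi => hf i hi

theorem principalSub_mulVec (A : Matrix ι ι ℝ) (α : Finset ι) (x : ι → ℝ)
    (hx : ∀ i, i ∉ α → x i = 0) (i : {i // i ∈ α}) :
    (principalSub A α *ᵥ fun j => x j) i = (A *ᵥ x) i :=
  sum_subtype_of_support α (fun j => A i j * x j) fun j hj => by simp [hx j hj]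

theorem dotProduct_principalSub_mulVec (A : Matrix ι ι ℝ) (α : Finset ι) (x : ι → ℝ)
    (hx : ∀ i, i ∉ α → x i = 0) :
    (fun i : {i // i ∈ α} => x i) ⬝ᵥ (principalSub A α *ᵥ fun j => x j) = x ⬝ᵥ (A *ᵥ x) := by
  have h : (principalSub A α *ᵥ fun j : {i // i ∈ α} => x j) = fun i => (A *ᵥ x) i.1 :=
    funext (principalSub_mulVec A α x hx)
  rw [h]
  exact sum_subtype_of_support α (fun j => x j * (A *ᵥ x) j) fun j hj => by simp [hx j hj]

theorem IsCopositive.of_principalSub {A : Matrix ι ι ℝ} {α : Finset ι}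
    (h : IsCopositive (principalSub A α)) (x : ι → ℝ) (h0 : 0 ≤ x)
    (hx : ∀ i, i ∉ α → x i = 0) : 0 ≤ x ⬝ᵥ (A *ᵥ x) := by
  rw [← dotProduct_principalSub_mulVec A α x hx]
  exact h _ fun i => h0 i

theorem IsE0.of_principalSub {A : Matrix ι ι ℝ} {α : Finset ι}
    (h : IsE0 (principalSub A α)) (x : ι → ℝ) (h0 : 0 ≤ x) (hne : x ≠ 0)
    (hx : ∀ i, i ∉ α → x i = 0) : ∃ i ∈ α, 0 < x i ∧ 0 ≤ (A *ᵥ x) i := by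
  obtain ⟨i, hi, hi'⟩ := h (fun i => x i) (fun i => h0 i) fun hz => hne <| funext fun i => by
    by_cases hi : i ∈ α
    · exact congrFun hz ⟨i, hi⟩
    · exact hx i hi
  rw [principalSub_mulVec A α x hx] at hi'
  exact ⟨i, i.2, hi, hi'⟩

theorem IsE0s.of_principalSub {A : Matrix ι ι ℝ} {α : Finset ι}
    (h : IsE0s (principalSub A α)) (x : ι → ℝ) (h0 : 0 ≤ x)
    (hx : ∀ i, i ∉ α → x i = 0) (hq : x ⬝ᵥ (A *ᵥ x) = 0) (hA : ∀ i ∈ α, 0 ≤ (A *ᵥ x) i) :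
    ∀ i ∈ α, (Aᵀ *ᵥ x) i ≤ 0 := by
  intro i hi
  have h1 := h.2 (fun i => x i) (by rwa [dotProduct_principalSub_mulVec A α x hx])
    (fun i => by
      rw [principalSub_mulVec A α x hx]
      exact hA i i.2) (fun i => h0 i) ⟨i, hi⟩
  exact (principalSub_mulVec Aᵀ α x hx ⟨i, hi⟩).symm.trans_le h1

end PrincipalSub

/-! ### Sign pattern from the order-two `E₀ˢ` conditions -/

section Pairs

variable {ι : Type*} [Fintype ι] [DecidableEq ι]

theorem mulVec_pair (A : Matrix ι ι ℝ) (k j : ι) (s t : ℝ) (i : ι) :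
    (A *ᵥ (Pi.single k s + Pi.single j t)) i = A i k * s + A i j * t := by
  simp [mulVec_add, mulVec_single, mul_comm]

theorem dotProduct_mulVec_pair (A : Matrix ι ι ℝ) (k j : ι) (s t : ℝ) :
    (Pi.single k s + Pi.single j t) ⬝ᵥ (A *ᵥ (Pi.single k s + Pi.single j t))
      = s * (A k k * s + A k j * t) + t * (A j k * s + A j j * t) := by
  rw [add_dotProduct, single_dotProduct, single_dotProduct, mulVec_pair, mulVec_pair]

theorem pair_nonneg (k j : ι) {s t : ℝ} (hs : 0 ≤ s) (ht : 0 ≤ t) :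
    (0 : ι → ℝ) ≤ Pi.single k s + Pi.single j t :=
  add_nonneg (Pi.single_nonneg.2 hs) (Pi.single_nonneg.2 ht)

theorem pair_support {k j : ι} (s t : ℝ) {i : ι} (hk : i ≠ k) (hj : i ≠ j) :
    (Pi.single k s + Pi.single j t : ι → ℝ) i = 0 := by
  simp [hk, hj]

theorem diag_nonneg_of_isE0 (M : Matrix ι ι ℝ) (k : ι) (h : IsE0 (principalSub M {k})) :
    0 ≤ M k k := by
  obtain ⟨i, hi, -, h2⟩ := h.of_principalSub (Pi.single k 1) (Pi.single_nonneg.2 zero_le_one)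
    (by simp) fun i hi => by simp [Finset.mem_singleton.not.1 hi]
  rw [Finset.mem_singleton.1 hi] at h2
  simpa using h2

theorem not_both_neg_of_isE0 (M : Matrix ι ι ℝ) {k j : ι} (hkj : j ≠ k)
    (h : ∀ x : ι → ℝ, 0 ≤ x → x ≠ 0 → (∀ i, i ∉ ({k, j} : Finset ι) → x i = 0) →
      ∃ i ∈ ({k, j} : Finset ι), 0 < x i ∧ 0 ≤ (M *ᵥ x) i)
    (h0 : M k k = 0) (h1 : M k j < 0) : 0 ≤ M j k := by
  by_contra! h2
  -- Small enough that `M j k` dominates `M j j * t`, so both relevant coordinates of the image are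
  -- negative.
  let t : ℝ := - M j k / (2 * (1 + |M j j|))
  have hden : 0 < 2 * (1 + |M j j|) := by positivity
  have ht : 0 < t := div_pos (by linarith) hden
  have hle := le_abs_self (M j j)
  have hnn := abs_nonneg (M j j)
  have htm : t * (2 * (1 + |M j j|)) = - M j k := div_mul_cancel₀ _ hden.ne'
  have hneg : M j k + M j j * t < 0 := by nlinarith
  obtain ⟨i, hi, -, h4⟩ := h (Pi.single k 1 + Pi.single j t)
    (pair_nonneg k j zero_le_one ht.le)
    (fun hz => by simpa [hkj.symm] using congrFun hz k)
    (fun i hi => pair_support _ _ (fun h => hi (by simp [h])) (fun h => hi (by simp [h])))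
  rw [mulVec_pair] at h4
  rcases Finset.mem_insert.1 hi with rfl | hi
  · rw [h0] at h4; nlinarith
  · rw [Finset.mem_singleton] at hi
    subst hi
    linarith

/-- The hypotheses make the unit vector at `k` a solution of the order-two homogeneous problem; the
star condition then bounds row `k`. -/
theorem nonpos_of_isE0s (M : Matrix ι ι ℝ) {k j : ι}
    (h : IsE0s (principalSub M {k, j})) (h0 : M k k = 0) (h1 : 0 ≤ M j k) : M k j ≤ 0 := by
  have := h.of_principalSub (Pi.single k 1) (Pi.single_nonneg.2 zero_le_one)
    (fun i hi => by
      have : i ≠ k := fun h => hi (by simp [h])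
      simp [this]) (by simp [h0])
    (fun i hi => by
      rcases Finset.mem_insert.1 hi with rfl | hi
      · simp [h0]
      · rw [Finset.mem_singleton.1 hi]; simpa using h1) j (by simp)
  simpa using this

theorem minor_pair_ne_zero (M : Matrix ι ι ℝ) (hM : HasFullRankOrderTwo M) {k j : ι}
    (hkj : k ≠ j) : minor M {k, j} ≠ 0 := by
  rw [minor_eq_det]
  have hr := hM {k, j} (Finset.card_pair hkj)
  have hcard : Fintype.card {i // i ∈ ({k, j} : Finset ι)} = 2 := by
    rw [Fintype.card_coe, Finset.card_pair hkj]
  have htop : LinearMap.range (principalSub M {k, j}).mulVecLin = ⊤ :=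
    Submodule.eq_top_of_finrank_eq (by rw [Module.finrank_fintype_fun_eq_card, hcard]; exact hr)
  have hunit : IsUnit (principalSub M {k, j}) :=
    Matrix.mulVec_surjective_iff_isUnit.1 (LinearMap.range_eq_top.1 htop)
  exact ((Matrix.isUnit_iff_isUnit_det _).1 hunit).ne_zero

theorem mul_neg_of_isCompletelyE0sTilde (M : Matrix ι ι ℝ) (hM : IsCompletelyE0sTilde M)
    (hr : HasFullRankOrderTwo M) {k j : ι} (hkj : j ≠ k) (h0 : M k k = 0) :
    M k j * M j k < 0 := by
  have hdet := minor_pair_ne_zero M hr hkj.symm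
  rw [minor_pair M hkj.symm, h0, zero_mul, zero_sub, neg_ne_zero] at hdet
  have hE := (hM {k, j}).1
  have hb := left_ne_zero_of_mul hdet
  have hc := right_ne_zero_of_mul hdet
  rcases le_or_gt 0 (M j k) with h | h
  · exact mul_neg_of_neg_of_pos (lt_of_le_of_ne (nonpos_of_isE0s M hE h0 h) hb)
      (lt_of_le_of_ne h hc.symm)
  · rcases lt_or_gt_of_ne hb with h1 | h1
    · exact absurd (not_both_neg_of_isE0 M hkj hE.1.of_principalSub h0 h1) h.not_ge
    · exact mul_neg_of_pos_of_neg h1 h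

theorem hasSignPattern_of_isCompletelyE0sTilde (M : Matrix ι ι ℝ)
    (hM : IsCompletelyE0sTilde M) (hr : HasFullRankOrderTwo M) : HasSignPattern M := fun k =>
  ⟨diag_nonneg_of_isE0 M k (hM {k}).1.1, fun h0 _ hj =>
    Or.inl (mul_neg_of_isCompletelyE0sTilde M hM hr hj h0)⟩

end Pairs

/-! ### Sign pattern from almost copositivity -/

section AlmostCopositive

variable {n : ℕ}

theorem IsCopositiveOfOrder.nonneg {M : Matrix (Fin n) (Fin n) ℝ}
    (hM : IsCopositiveOfOrder M (n - 1)) (x : Fin n → ℝ) (h0 : 0 ≤ x) (i : Fin n)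
    (hi : x i = 0) : 0 ≤ x ⬝ᵥ (M *ᵥ x) := by
  refine (hM (Finset.univ.erase i) (by simp)).of_principalSub x h0 fun j hj => ?_
  have : j = i := by simpa using hj
  rw [this, hi]

theorem not_isCopositive_of_order {M : Matrix (Fin n) (Fin n) ℝ}
    (hM : ¬ IsCopositiveOfOrder M n) : ∃ x : Fin n → ℝ, 0 ≤ x ∧ x ⬝ᵥ (M *ᵥ x) < 0 := by
  by_contra! hcon
  refine hM fun α hα x hx => ?_
  have huniv : α = Finset.univ := Finset.eq_univ_of_card α (by simpa using hα)
  have hmem : ∀ i, i ∈ α := by simp [huniv]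
  have h1 := hcon (fun i => x ⟨i, hmem i⟩) fun i => hx _
  rwa [← dotProduct_principalSub_mulVec M α (fun i => x ⟨i, hmem i⟩)
    fun i hi => absurd (hmem i) hi] at h1

theorem exists_boundary_point (x y : Fin n → ℝ) (hx : 0 ≤ x) (hy : ∃ j, y j < 0) :
    ∃ t : ℝ, 0 ≤ t ∧ 0 ≤ x + t • y ∧ ∃ i, (x + t • y) i = 0 := by
  obtain ⟨j₀, hj₀⟩ := hy
  obtain ⟨i, hi, hmin⟩ := Finset.exists_min_image (Finset.univ.filter fun j => y j < 0)
    (fun j => x j / (- y j)) ⟨j₀, by simpa using hj₀⟩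
  simp only [Finset.mem_filter, Finset.mem_univ, true_and] at hi hmin
  have ht : 0 ≤ x i / (- y i) := div_nonneg (hx i) (by linarith)
  refine ⟨x i / (- y i), ht, fun j => ?_, i, ?_⟩
  · simp only [Pi.zero_apply, Pi.add_apply, Pi.smul_apply, smul_eq_mul]
    rcases lt_or_ge (y j) 0 with hj | hj
    · have := hmin j hj
      rw [le_div_iff₀ (by linarith)] at this
      linarith
    · exact add_nonneg (hx j) (mul_nonneg ht hj)
  · have : y i ≠ 0 := hi.ne
    simp only [Pi.add_apply, Pi.smul_apply, smul_eq_mul]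
    field_simp
    ring

/-- The quadratic form of an almost copositive matrix is nonnegative on vectors with a zero
coordinate. -/
theorem IsAlmostCopositive.nonneg {M : Matrix (Fin n) (Fin n) ℝ} (hM : IsAlmostCopositive M)
    (y : Fin n → ℝ) (i : Fin n) (hi : y i = 0) : 0 ≤ y ⬝ᵥ (M *ᵥ y) := by
  obtain ⟨x, hx, hxq⟩ := not_isCopositive_of_order hM.2
  by_contra! hyq
  -- Moving from `x` along `z` keeps the form negative until a face of the orthant is reached, where
  -- copositivity of order `n - 1` forbids it. One of `y`, `-y` has the required cross term.
  have key : ∀ z : Fin n → ℝ, z i = 0 → z ⬝ᵥ (M *ᵥ z) < 0 →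
      x ⬝ᵥ (M *ᵥ z) + z ⬝ᵥ (M *ᵥ x) ≤ 0 → False := by
    intro z hzi hzq hb
    by_cases hz : ∃ j, z j < 0
    · obtain ⟨t, ht, hnn, l, hl⟩ := exists_boundary_point x z hx hz
      have h1 := hM.1.nonneg _ hnn l hl
      have h2 : (x + t • z) ⬝ᵥ (M *ᵥ (x + t • z)) = x ⬝ᵥ (M *ᵥ x)
          + t * (x ⬝ᵥ (M *ᵥ z) + z ⬝ᵥ (M *ᵥ x)) + t ^ 2 * (z ⬝ᵥ (M *ᵥ z)) := by
        simp only [mulVec_add, mulVec_smul, add_dotProduct, dotProduct_add, smul_dotProduct,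
          dotProduct_smul, smul_eq_mul]
        ring
      have h3 : t * (x ⬝ᵥ (M *ᵥ z) + z ⬝ᵥ (M *ᵥ x)) ≤ 0 := mul_nonpos_of_nonneg_of_nonpos ht hb
      have h4 : t ^ 2 * (z ⬝ᵥ (M *ᵥ z)) ≤ 0 :=
        mul_nonpos_of_nonneg_of_nonpos (sq_nonneg t) hzq.le
      linarith
    · push Not at hz
      exact absurd (hM.1.nonneg z hz i hzi) hzq.not_ge
  rcases le_total (x ⬝ᵥ (M *ᵥ y) + y ⬝ᵥ (M *ᵥ x)) 0 with h | h
  · exact key y hi hyq h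
  · refine key (-y) (by simp [hi]) (by simpa [mulVec_neg] using hyq) ?_
    simp only [mulVec_neg, dotProduct_neg, neg_dotProduct]
    linarith

theorem IsAlmostCopositive.diag_nonneg {M : Matrix (Fin n) (Fin n) ℝ}
    (hM : IsAlmostCopositive M) (hn : 2 ≤ n) (k : Fin n) : 0 ≤ M k k := by
  have : Nontrivial (Fin n) := Fin.nontrivial_iff_two_le.2 hn
  obtain ⟨i, hi⟩ := exists_ne k
  have := hM.nonneg (Pi.single k 1) i (by simp [hi])
  simpa using this

theorem hasSignPattern_of_isAlmostCopositive (M : Matrix (Fin n) (Fin n) ℝ)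
    (hM : IsAlmostCopositive M) (hn : 3 ≤ n) : HasSignPattern M := by
  refine fun k => ⟨hM.diag_nonneg (by omega) k, fun h0 j _ => ?_⟩
  -- This is where `3 ≤ n` enters: a third coordinate is zero, so `s` below may have either sign,
  -- and an affine function bounded below on the line is constant.
  obtain ⟨i, hi⟩ : ∃ i, i ∉ ({k, j} : Finset (Fin n)) := by
    by_contra! h
    have h1 := Finset.card_le_card (fun i _ => h i : Finset.univ ⊆ ({k, j} : Finset (Fin n)))
    have h2 := Finset.card_le_two (a := k) (b := j)
    rw [Finset.card_univ, Fintype.card_fin] at h1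
    omega
  have hq : ∀ s, 0 ≤ s * (M k j + M j k) + M j j := fun s => by
    have := hM.nonneg (Pi.single k s + Pi.single j 1) i
      (pair_support s 1 (fun h => hi (by simp [h])) fun h => hi (by simp [h]))
    rw [dotProduct_mulVec_pair, h0] at this
    linarith
  have hsum : M k j + M j k = 0 := by
    by_contra hne
    have := hq (-(M j j + 1) / (M k j + M j k))
    rw [div_mul_cancel₀ _ hne] at this
    linarith
  have hjk : M j k = - M k j := by linarith
  by_cases hz : M k j = 0
  · exact Or.inr ⟨hz, by rw [hjk, hz, neg_zero]⟩
  · left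
    have : 0 < M k j ^ 2 := by positivity
    rw [hjk]
    linarith

end AlmostCopositive

/-! ### The case `n = 2` -/

section OrderTwo

theorem isColumnSufficient_fin_two (A : Matrix (Fin 2) (Fin 2) ℝ) (h0 : 0 ≤ A 0 0)
    (h1 : 0 ≤ A 1 1) (hdet : 0 < A.det) : IsColumnSufficient A := by
  intro x hx
  rw [det_fin_two] at hdet
  have hp := hx 0
  have hq := hx 1
  simp only [mulVec, dotProduct, Fin.sum_univ_two] at hp hq
  have ha : 0 ≤ A 0 0 * x 0 ^ 2 := by positivity
  have hd : 0 ≤ A 1 1 * x 1 ^ 2 := by positivity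
  -- Multiplying the two sign conditions bounds `A.det * (x 0 * x 1) ^ 2` above by zero.
  have hle : (A 0 0 * x 0 ^ 2) * (A 1 1 * x 1 ^ 2)
      ≤ (-(A 0 1 * x 0 * x 1)) * (-(A 1 0 * x 0 * x 1)) :=
    mul_le_mul (by linarith) (by linarith) hd (by linarith)
  have hprod : x 0 * x 1 = 0 := by
    have h2 : (A 0 0 * A 1 1 - A 0 1 * A 1 0) * (x 0 * x 1) ^ 2 ≤ 0 := by linarith
    have h3 : (x 0 * x 1) ^ 2 ≤ 0 := nonpos_of_mul_nonpos_right h2 hdet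
    exact pow_eq_zero_iff two_ne_zero |>.1 (le_antisymm h3 (sq_nonneg _))
  have e0 : x 0 * (A 0 0 * x 0 + A 0 1 * x 1) = A 0 0 * x 0 ^ 2 := by
    linear_combination A 0 1 * hprod
  have e1 : x 1 * (A 1 0 * x 0 + A 1 1 * x 1) = A 1 1 * x 1 ^ 2 := by
    linear_combination A 1 0 * hprod
  intro i
  fin_cases i
  · simp only [mulVec, dotProduct, Fin.sum_univ_two, Fin.zero_eta]
    linarith
  · simp only [mulVec, dotProduct, Fin.sum_univ_two, Fin.mk_one]
    linarith

theorem isSufficient_fin_two (A : Matrix (Fin 2) (Fin 2) ℝ) (hE0 : IsE0 A) (hA : A.det ≠ 0)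
    (hppt : ∀ M : Matrix (Fin 2) (Fin 2) ℝ, IsLegitimatePPT A M →
      IsAlmostCopositive M ∨ (IsCompletelyE0sTilde M ∧ HasFullRankOrderTwo M)) :
    IsSufficient A := by
  have hdiag : ∀ α, minor A α ≠ 0 → ∀ k, 0 ≤ ppt A α k k := fun α hα k => by
    rcases hppt _ ⟨α, by rwa [← minor_eq_det], rfl⟩ with h | h
    · exact h.diag_nonneg le_rfl k
    · exact diag_nonneg_of_isE0 _ k (h.1 {k}).1.1
  have hempty : minor A ∅ ≠ 0 := by simp [minor_empty]
  have hself : ppt A ∅ = A := by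
    have h := ppt_mul_pivRow A ∅ hempty
    have h1 : pivRow A ∅ = 1 := by ext i j; simp [pivRow]
    have h2 : pivRow A ∅ᶜ = A := by ext i j; simp [pivRow]
    rwa [h1, h2, Matrix.mul_one] at h
  have hd : ∀ k, 0 ≤ A k k := fun k => by simpa [hself] using hdiag ∅ hempty k
  have hneg : ∀ k j, j ≠ k → A k k = 0 → A k j * A j k ≠ 0 → A k j * A j k < 0 := by
    intro k j hkj h0 hne
    rcases hppt A ⟨∅, by rwa [← minor_eq_det], hself.symm⟩ with h | h
    · have hcover : ∀ i, i = k ∨ i = j := by omega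
      refine lt_of_le_of_ne (not_lt.1 fun hpos => ?_) hne
      -- Two positive off-diagonal entries would make `A` entrywise nonnegative, hence copositive;
      -- two negative ones contradict `E₀`.
      rcases pos_and_pos_or_neg_and_neg_of_mul_pos hpos with ⟨h1, h2⟩ | ⟨h1, h2⟩
      · obtain ⟨x, hx, hxq⟩ := not_isCopositive_of_order h.2
        refine hxq.not_ge (dotProduct_nonneg_of_nonneg hx fun i =>
          dotProduct_nonneg_of_nonneg (fun l => ?_) hx)
        change 0 ≤ A i l
        rcases hcover i with rfl | rfl <;> rcases hcover l with rfl | rfl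
        exacts [h0.ge, h1.le, h2.le, hd _]
      · refine (not_both_neg_of_isE0 A hkj (fun x hx hx0 _ => ?_) h0 h1).not_gt h2
        obtain ⟨i, hi⟩ := hE0 x hx hx0
        exact ⟨i, by simpa using hcover i, hi⟩
    · exact mul_neg_of_isCompletelyE0sTilde A h.1 h.2 hkj h0
  have hoff : A 0 0 * A 1 1 = 0 → A 0 1 * A 1 0 < 0 := by
    intro hz
    have hne : A 0 1 * A 1 0 ≠ 0 := fun h => hA (by rw [det_fin_two, hz, h, sub_zero])
    rcases mul_eq_zero.1 hz with h | h
    · exact hneg 0 1 one_ne_zero h hne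
    · rw [mul_comm] at hne ⊢
      exact hneg 1 0 zero_ne_one h hne
  have hdet : 0 < A.det := by
    rw [det_fin_two]
    by_cases hz : A 0 0 * A 1 1 = 0
    · linarith [hoff hz]
    · have h00 : 0 < A 0 0 := lt_of_le_of_ne (hd 0) (left_ne_zero_of_mul hz).symm
      have hne : minor A {0} ≠ 0 := by rw [minor_singleton]; exact h00.ne'
      -- The Schur complement `A.det / A 0 0` is a diagonal entry of a PPT, hence nonnegative.
      have h1 := minor_ppt A {0} {1} hne
      have h2 : ({0} ∆ {1} : Finset (Fin 2)) = Finset.univ := by decide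
      rw [h2, minor_univ, minor_singleton, minor_singleton] at h1
      have h3 : 0 ≤ A.det := h1 ▸ mul_nonneg (hdiag _ hne 1) h00.le
      rw [← det_fin_two]
      exact lt_of_le_of_ne h3 hA.symm
  exact ⟨isColumnSufficient_fin_two A (hd 0) (hd 1) hdet,
    isColumnSufficient_fin_two Aᵀ (hd 0) (hd 1) (by rwa [det_transpose])⟩

end OrderTwo

end LCP

theorem mainTheorem4 {n : ℕ} (A : Matrix (Fin n) (Fin n) ℝ)
    (hE0 : LCP.IsE0 A)
    (hpp : LCP.HasPlusPlus A)
    (hn : n = 2 → A.det ≠ 0)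
    (hppt : ∀ M : Matrix (Fin n) (Fin n) ℝ, LCP.IsLegitimatePPT A M →
      LCP.IsAlmostCopositive M ∨
        (LCP.IsCompletelyE0sTilde M ∧ LCP.HasFullRankOrderTwo M)) :
    LCP.IsSufficient A := by
  rcases Nat.lt_or_ge n 3 with h3 | h3
  · interval_cases n
    · exact ⟨fun _ _ i => i.elim0, fun _ _ i => i.elim0⟩
    · have ha : 0 ≤ A 0 0 := by
        obtain ⟨i, -, hi⟩ := hE0 1 zero_le_one one_ne_zero
        rw [Subsingleton.elim i 0] at hi
        simpa [Matrix.mulVec, dotProduct] using hi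
      have key : ∀ B : Matrix (Fin 1) (Fin 1) ℝ, 0 ≤ B 0 0 → LCP.IsColumnSufficient B := by
        intro B hB x hx i
        refine le_antisymm (hx i) ?_
        rw [Subsingleton.elim i 0]
        have : x 0 * (B.mulVec x) 0 = B 0 0 * x 0 ^ 2 := by
          simp [Matrix.mulVec, dotProduct]
          ring
        rw [this]
        positivity
      exact ⟨key A ha, key A.transpose ha⟩
    · exact LCP.isSufficient_fin_two A hE0 (hn rfl) hppt
  · refine LCP.isSufficient_of_hasSignPattern A fun α hα => ?_
    rcases hppt _ ⟨α, by rwa [← LCP.minor_eq_det], rfl⟩ with h | h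
    · exact LCP.hasSignPattern_of_isAlmostCopositive _ h h3
    · exact LCP.hasSignPattern_of_isCompletelyE0sTilde _ h.1 h.2
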